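/- Let $G$ be a finite group of order $N$, let $S\subseteq G$ be closed under conjugation ($xSx^{-1}=S$ for all $x\in G$), and let $\Gamma=\mathrm{Cay}(G;S)$ be the (directed) Cayley graph with vertex set $G$ and an edge from $x$ to $y$ if and only if $x^{-1}y\in S$. Let $\widehat G$ be the set of equivalence classes of irreducible unitary representations of $G$; for each class choose a representative $\pi:G\to U_{d_\pi}(\mathbb C)$, write $\pi_{ij}(x)$ for the entries and $\chi_\pi(x)$ for the trace of $\pi(x)$, and put $$\phi^\pi_{ij}:=\sqrt{\tfrac{d_\pi}{N}}\,\pi_{ij}\in\mathbb C^G\qquad(\pi\in\widehat G,\ 1\le i,j\le d_\pi).$$ Then the vectors $\phi^\pi_{ij}$ form an orthonormal basis of $\mathbb C^G$, and the adjacency matrix $A_\Gamma$ satisfies $A_\Gamma\phi^\pi_{ij}=\bigl(\frac1{d_\pi}\sum_{s\in S}\chi_\pi(s)\bigr)\phi^\pi_{ij}$ for all $\pi,i,j$. Moreover, let $\Phi$ be the matrix whose columns are the vectors $\phi^\pi_{ij}$, and list these columns as $\phi_1,\dots,\phi_N$. Let $0\ne\mathfrak g\in\mathbb C^G$ be such that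 $\widehat{\mathfrak g}(\phi^\pi_{ij}):=\sum_{x\in G}\mathfrak g(x)\overline{\phi^\pi_{ij}(x)}$ is equal, for every $\pi\in\widehat G$ and all $1\le i,j\le d_\pi$, to a constant $\widehat{\mathfrak g}_\pi\in\mathbb C$ that depends only on $\pi$. Let $\{f_m\}_{m=1}^N$ be an orthonormal basis of $\mathbb C^N$ (coordinates indexed as the columns of $\Phi$), let $D_{f_m}$ be the diagonal matrix with diagonal $f_m$, let $A_m=\Phi D_{f_m}\Phi^*$, and let $\mathfrak g_{m,\ell}:=\phi_\ell\circ(A_m\mathfrak g)$ for $m,\ell=1,\dots,N$, where $\circ$ is the entrywise product. Then $\{\mathfrak g_{m,\ell}\}_{m,\ell=1}^N$ is a tight frame for $\mathbb C^G$ whose optimal lower and upper frame bounds are both $$\frac1N\sum_{\pi\in\widehat G}|\widehat{\mathfrak g}_\pi|^2d_\pi^2 .$$ (A finite family $\{\psi_x\}$ is a frame if $A\|f\|^2\le\sum_x|\langle f,\psi_x\rangle|^2\le B\|f\|^2$ for all $f$, for some constants $A,B>0$; the optimal bounds are the largest such $A$ and the smallest such $B$.) -/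

import Mathlib

open scoped Matrix

noncomputable section

/-! ### Frames -/

/-- The positive lower frame bounds of a finite family of vectors. -/
def lowerFrameBounds {ι H : Type*} [Fintype ι] [NormedAddCommGroup H] [InnerProductSpace ℂ H]
    (ψ : ι → H) : Set ℝ :=
  {A | 0 < A ∧ ∀ f : H, A * ‖f‖ ^ 2 ≤ ∑ x, ‖inner ℂ (ψ x) f‖ ^ 2}

/-- The positive upper frame bounds of a finite family of vectors. -/
def upperFrameBounds {ι H : Type*} [Fintype ι] [NormedAddCommGroup H] [InnerProductSpace ℂ H]
    (ψ : ι → H) : Set ℝ :=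
  {B | 0 < B ∧ ∀ f : H, ∑ x, ‖inner ℂ (ψ x) f‖ ^ 2 ≤ B * ‖f‖ ^ 2}

/-- A finite family is a frame if it has a positive lower and a positive upper frame bound. -/
def IsFrame {ι H : Type*} [Fintype ι] [NormedAddCommGroup H] [InnerProductSpace ℂ H]
    (ψ : ι → H) : Prop :=
  (lowerFrameBounds ψ).Nonempty ∧ (upperFrameBounds ψ).Nonempty

/-- The family is a tight frame and its optimal lower and upper frame bounds are both `c`. -/
def IsTightFrameWithBound {ι H : Type*} [Fintype ι] [NormedAddCommGroup H]
    [InnerProductSpace ℂ H] (ψ : ι → H) (c : ℝ) : Prop :=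
  IsFrame ψ ∧ IsGreatest (lowerFrameBounds ψ) c ∧ IsLeast (upperFrameBounds ψ) c

/-! ### Signals on a finite vertex set `V`, with respect to a family `φ` of vectors -/

/-- The Fourier coefficient `⟨f, φ a⟩ = ∑ x, f x * conj (φ a x)`.  (Mathlib's inner product is
conjugate linear in the first variable.) -/
def graphFourier {V κ : Type*} [Fintype V] (φ : κ → EuclideanSpace ℂ V)
    (f : EuclideanSpace ℂ V) (a : κ) : ℂ :=
  inner ℂ (φ a) f

/-- The matrix `Φ` whose columns are the vectors `φ a`. -/
def synthesisMatrix {V κ : Type*} (φ : κ → EuclideanSpace ℂ V) : Matrix V κ ℂ :=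
  Matrix.of fun x a => φ a x

open Classical in
/-- The Fourier multiplier `Φ D_w Φ^*`. -/
def fourierMultiplier {V κ : Type*} [Fintype κ] (φ : κ → EuclideanSpace ℂ V)
    (w : EuclideanSpace ℂ κ) : Matrix V V ℂ :=
  synthesisMatrix φ * Matrix.diagonal (fun a => w a) * (synthesisMatrix φ)ᴴ

/-- The family `g_{m,ℓ} = φ_ℓ ∘ (A_m g)` (entrywise product). -/
def gaborFamily {V κ ι : Type*} [Fintype V] (φ : κ → EuclideanSpace ℂ V)
    (A : ι → Matrix V V ℂ) (g : EuclideanSpace ℂ V) : ι × κ → EuclideanSpace ℂ V :=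
  fun p => WithLp.toLp 2 fun x => φ p.2 x * (A p.1 *ᵥ fun y => g y) x

/-! ### Cayley graphs -/

/-- The directed graph on `G` with an edge from `x` to `y` if and only if `x⁻¹ * y ∈ S`. -/
def cayleyDigraph {G : Type*} [Group G] (S : Set G) : Digraph G where
  Adj x y := x⁻¹ * y ∈ S

open Classical in
/-- The adjacency matrix of a directed graph. -/
def digraphAdjMatrix {V : Type*} (Γ : Digraph V) : Matrix V V ℂ :=
  Matrix.of fun x y => if Γ.Adj x y then 1 else 0

/-! ### Irreducible unitary representations -/

/-- The linear representation on `ℂ^d` given by a homomorphism into the unitary group `U_d(ℂ)`. -/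
def unitaryToRepresentation {G : Type*} [Group G] {d : ℕ}
    (π : G →* Matrix.unitaryGroup (Fin d) ℂ) : Representation ℂ G (Fin d → ℂ) where
  toFun g := Matrix.toLin' (π g : Matrix (Fin d) (Fin d) ℂ)
  map_one' := by simp; rfl
  map_mul' x y := by simp [Matrix.toLin'_mul, Module.End.mul_eq_comp]

/-- An irreducible unitary matrix representation of `G`. -/
structure IrredUnitaryRep (G : Type*) [Group G] where
  /-- the degree `d_π` -/
  deg : ℕ
  /-- the homomorphism into the unitary group -/
  toHom : G →* Matrix.unitaryGroup (Fin deg) ℂ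
  irreducible : (unitaryToRepresentation toHom).IsIrreducible

namespace IrredUnitaryRep

variable {G : Type*} [Group G]

/-- The underlying linear representation. -/
def toRep (π : IrredUnitaryRep G) : Representation ℂ G (Fin π.deg → ℂ) :=
  unitaryToRepresentation π.toHom

/-- The coordinate functional `π_{ij}(g) = ⟨π(g) e_j, e_i⟩`. -/
def coeff (π : IrredUnitaryRep G) (i j : Fin π.deg) (g : G) : ℂ :=
  (π.toHom g : Matrix (Fin π.deg) (Fin π.deg) ℂ) i j

/-- The character `χ_π(g) = Tr π(g)`. -/
def character (π : IrredUnitaryRep G) (g : G) : ℂ :=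
  (π.toHom g : Matrix (Fin π.deg) (Fin π.deg) ℂ).trace

end IrredUnitaryRep

/-- Equivalence (isomorphism) of irreducible unitary representations. -/
instance irredUnitaryRepSetoid (G : Type*) [Group G] : Setoid (IrredUnitaryRep G) where
  r π σ := Nonempty (π.toRep.Equiv σ.toRep)
  iseqv :=
    { refl := fun _ => ⟨Representation.Equiv.refl _⟩
      symm := fun ⟨e⟩ => ⟨e.symm⟩
      trans := fun ⟨e⟩ ⟨e'⟩ => ⟨e.trans e'⟩ }

/-- The unitary dual `Ĝ`: the set of equivalence classes of irreducible unitary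
representations of `G`. -/
def UnitaryDual (G : Type*) [Group G] : Type _ :=
  Quotient (irredUnitaryRepSetoid G)

/-- The class of an irreducible unitary representation in the unitary dual. -/
def IrredUnitaryRep.cls {G : Type*} [Group G] (π : IrredUnitaryRep G) : UnitaryDual G :=
  Quotient.mk (irredUnitaryRepSetoid G) π

/-! ### Finiteness of the unitary dual, so that one can sum over it -/

/-- Matrix coefficients of inequivalent irreducible unitary representations are orthogonal. -/
theorem IrredUnitaryRep.sum_coeff_eq_zero {G : Type*} [Group G] [Fintype G]
    (π σ : IrredUnitaryRep G) (h : π.cls ≠ σ.cls) (i j : Fin π.deg) (k l : Fin σ.deg) :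
    ∑ g, star (π.coeff i j g) * σ.coeff k l g = 0 := by
  let P : G → Matrix (Fin π.deg) (Fin π.deg) ℂ := fun g => π.toHom g
  let Q : G → Matrix (Fin σ.deg) (Fin σ.deg) ℂ := fun g => σ.toHom g
  let M : Matrix (Fin σ.deg) (Fin π.deg) ℂ := ∑ g, Q g * (Matrix.single l j (1 : ℂ) * (P g)ᴴ)
  have hPmul : ∀ x y, P (x * y) = P x * P y := fun x y => by simp [P]
  have hQmul : ∀ x y, Q (x * y) = Q x * Q y := fun x y => by simp [Q]
  have hPstar : ∀ x, (P x)ᴴ * P x = 1 := fun x =>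
    Matrix.mem_unitaryGroup_iff'.mp (π.toHom x).2
  have hM : ∀ x, M * P x = Q x * M := by
    intro x
    simp only [M, Matrix.sum_mul, Matrix.mul_sum]
    rw [← Equiv.sum_comp (Equiv.mulLeft x)]
    refine Finset.sum_congr rfl fun g _ => ?_
    simp only [Equiv.coe_mulLeft, hPmul, hQmul, Matrix.mul_assoc, Matrix.conjTranspose_mul, hPstar,
      Matrix.mul_one]
  let T : π.toRep.IntertwiningMap σ.toRep :=
    { toLinearMap := Matrix.toLin' M
      isIntertwining' := fun x => by
        change Matrix.toLin' M ∘ₗ Matrix.toLin' (P x) = Matrix.toLin' (Q x) ∘ₗ Matrix.toLin' M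
        rw [← Matrix.toLin'_mul, ← Matrix.toLin'_mul, hM] }
  have : π.toRep.IsIrreducible := π.irreducible
  have : σ.toRep.IsIrreducible := σ.irreducible
  have hT : T = 0 := by
    refine (Representation.IsIrreducible.bijective_or_eq_zero T).resolve_left fun hb => h ?_
    exact Quotient.sound ⟨T.ofBijective hb⟩
  have hM0 : M = 0 := by
    have : Matrix.toLin' M = 0 := congrArg (fun t => t.toLinearMap) hT
    simpa using this
  have := congrFun (congrFun hM0 k) i
  simp only [M, Matrix.sum_apply, Matrix.zero_apply] at this
  rw [← this]
  refine Finset.sum_congr rfl fun g _ => ?_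
  rw [Matrix.mul_apply, Finset.sum_eq_single l]
  · simp [IrredUnitaryRep.coeff, P, Q, mul_comm]
  · intro b _ hb
    simp [Matrix.single_mul_apply_of_ne, hb]
  · simp

theorem IrredUnitaryRep.deg_pos {G : Type*} [Group G] (π : IrredUnitaryRep G) : 0 < π.deg := by
  rcases Nat.eq_zero_or_pos π.deg with h | h
  · exfalso
    have : π.toRep.IsIrreducible := π.irreducible
    have hs : Subsingleton (Fin π.deg → ℂ) := by rw [h]; infer_instance
    obtain ⟨a, b, hab⟩ := exists_pair_ne (Subrepresentation π.toRep)
    exact hab (Subrepresentation.toSubmodule_injective (Subsingleton.elim _ _))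
  · exact h

instance unitaryDual_finite {G : Type*} [Group G] [Finite G] : Finite (UnitaryDual G) := by
  have := Fintype.ofFinite G
  let v : UnitaryDual G → EuclideanSpace ℂ G := fun c =>
    WithLp.toLp 2 fun g => (Quotient.out c).coeff ⟨0, (Quotient.out c).deg_pos⟩
      ⟨0, (Quotient.out c).deg_pos⟩ g
  have hv : LinearIndependent ℂ v := by
    refine linearIndependent_of_ne_zero_of_inner_eq_zero (𝕜 := ℂ) (fun c hc => ?_)
      fun c c' hcc => ?_
    · have := congrArg (fun w : EuclideanSpace ℂ G => w 1) hc
      simp [v, IrredUnitaryRep.coeff] at this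
    · have := IrredUnitaryRep.sum_coeff_eq_zero (Quotient.out c) (Quotient.out c')
        (fun h => hcc (by
          rw [← Quotient.out_eq c, ← Quotient.out_eq c']; exact h))
        ⟨0, (Quotient.out c).deg_pos⟩ ⟨0, (Quotient.out c).deg_pos⟩
        ⟨0, (Quotient.out c').deg_pos⟩ ⟨0, (Quotient.out c').deg_pos⟩
      rw [← this]
      simp [v, PiLp.inner_apply, mul_comm]
  exact hv.finite_of_isNoetherian

instance unitaryDual_fintype {G : Type*} [Group G] [Finite G] : Fintype (UnitaryDual G) :=
  Fintype.ofFinite _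

/-! ### The basis of scaled coordinate functionals -/

/-- The triples `(π, i, j)` with `π ∈ Ĝ` and `1 ≤ i, j ≤ d_π`, for a choice `rep` of
representatives of the classes in `Ĝ`. -/
abbrev CoeffIndex {G : Type*} [Group G] (rep : UnitaryDual G → IrredUnitaryRep G) : Type _ :=
  Σ π : UnitaryDual G, Fin (rep π).deg × Fin (rep π).deg

/-- The vectors `φ^π_{ij} = √(d_π / N) π_{ij}`, where `N` is the order of `G`. -/
def cayleyBasis {G : Type*} [Group G] [Fintype G] (rep : UnitaryDual G → IrredUnitaryRep G)
    (a : CoeffIndex rep) : EuclideanSpace ℂ G :=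
  WithLp.toLp 2 fun x =>
    (Real.sqrt ((rep a.1).deg / Fintype.card G) : ℂ) * (rep a.1).coeff a.2.1 a.2.2 x

end

/-! Orthonormality is Schur orthogonality: averaging a matrix unit over the group yields an
intertwiner, which is zero or scalar. Completeness is Peter–Weyl for a finite group: the orthogonal
complement of the coefficients is invariant under right translation, and a minimal invariant
subspace of it would consist of coefficients. The adjacency matrix sums right translates over `S`;
conjugation invariance makes `∑ π(s)` scalar by Schur's lemma.

For the frame, `sum_norm_inner_gaborFamily_sq` applies Parseval over `ℓ` (the basis `φ`) and over
`m` (the multipliers), turning the frame sum into `∑ x, W x * ‖f x‖ ^ 2` with `W x = ∑ a, ‖ĝ a‖ ^ 2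
* ‖φ a x‖ ^ 2`. Since `ĝ` is constant on each block `π` and the block's squared moduli sum to `d_π ^
2 / N` at every vertex, `W` is constant and equals the claimed bound. -/

/-! ### Schur's lemma and orthogonality relations. -/

namespace IrredUnitaryRep

variable {G : Type*} [Group G]

theorem coeff_mul (π : IrredUnitaryRep G) (i j : Fin π.deg) (x y : G) :
    π.coeff i j (x * y) = ∑ k, π.coeff i k x * π.coeff k j y := by
  simp [coeff, Matrix.mul_apply]

theorem sum_star_coeff_mul_coeff_self (π : IrredUnitaryRep G) (j l : Fin π.deg) (g : G) :
    ∑ i, star (π.coeff i j g) * π.coeff i l g = if j = l then 1 else 0 := by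
  have h := congrFun (congrFun (Matrix.mem_unitaryGroup_iff'.mp (π.toHom g).2) j) l
  simpa [Matrix.mul_apply, Matrix.one_apply, coeff, Matrix.star_apply] using h

/-- **Schur's lemma**: a matrix commuting with an irreducible unitary representation is scalar. -/
theorem eq_trace_smul_one_of_commute (π : IrredUnitaryRep G)
    (M : Matrix (Fin π.deg) (Fin π.deg) ℂ)
    (hM : ∀ x, M * (π.toHom x : Matrix (Fin π.deg) (Fin π.deg) ℂ) = π.toHom x * M) :
    M = ((1 / π.deg : ℂ) * M.trace) • 1 := by
  let T : π.toRep.IntertwiningMap π.toRep :=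
    { toLinearMap := Matrix.toLin' M
      isIntertwining' := fun x => by
        change Matrix.toLin' M ∘ₗ Matrix.toLin' (π.toHom x : Matrix _ _ ℂ)
          = Matrix.toLin' (π.toHom x : Matrix _ _ ℂ) ∘ₗ Matrix.toLin' M
        rw [← Matrix.toLin'_mul, ← Matrix.toLin'_mul, hM] }
  have : π.toRep.IsIrreducible := π.irreducible
  obtain ⟨c, hc⟩ :=
    (Representation.IsIrreducible.algebraMap_intertwiningMap_bijective_of_isAlgClosed
      (ρ := π.toRep)).2 T
  have hMc : M = c • 1 := by
    apply Matrix.toLin'.injective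
    have h : Matrix.toLin' M = (algebraMap ℂ (π.toRep.IntertwiningMap π.toRep) c).toLinearMap :=
      congrArg (fun t => t.toLinearMap) hc.symm
    rw [h, Algebra.algebraMap_eq_smul_one]
    ext
    simp
  have hd : (π.deg : ℂ) ≠ 0 := by exact_mod_cast π.deg_pos.ne'
  have htr : M.trace = c * π.deg := by simp [hMc, Matrix.trace_smul]
  rw [htr, show (1 / π.deg : ℂ) * (c * π.deg) = c by field_simp]
  exact hMc

/-- Schur orthogonality for the matrix coefficients of one irreducible representation. -/
theorem sum_star_coeff_mul_coeff [Fintype G] (π : IrredUnitaryRep G) (i j k l : Fin π.deg) :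
    ∑ g, star (π.coeff i j g) * π.coeff k l g =
      if i = k ∧ j = l then (Fintype.card G / π.deg : ℂ) else 0 := by
  let P : G → Matrix (Fin π.deg) (Fin π.deg) ℂ := fun g => π.toHom g
  -- The `(k, i)` entry of this average is the required sum, while each summand has the trace of the
  -- matrix unit; this fixes the scalar.
  let M : Matrix (Fin π.deg) (Fin π.deg) ℂ := ∑ g, P g * (Matrix.single l j (1 : ℂ) * (P g)ᴴ)
  have hPmul : ∀ x y, P (x * y) = P x * P y := fun x y => by simp [P]
  have hPstar : ∀ x, (P x)ᴴ * P x = 1 := fun x =>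
    Matrix.mem_unitaryGroup_iff'.mp (π.toHom x).2
  have hM : ∀ x, M * P x = P x * M := by
    intro x
    simp only [M, Matrix.sum_mul, Matrix.mul_sum]
    rw [← Equiv.sum_comp (Equiv.mulLeft x)]
    refine Finset.sum_congr rfl fun g _ => ?_
    simp only [Equiv.coe_mulLeft, hPmul, Matrix.mul_assoc, Matrix.conjTranspose_mul, hPstar,
      Matrix.mul_one]
  have hentry : ∑ g, star (π.coeff i j g) * π.coeff k l g = M k i := by
    simp only [M, Matrix.sum_apply]
    refine Finset.sum_congr rfl fun g _ => ?_
    rw [Matrix.mul_apply, Finset.sum_eq_single l]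
    · simp [coeff, P, mul_comm]
    · intro b _ hb
      simp [Matrix.single_mul_apply_of_ne, hb]
    · simp
  have htr : M.trace = Fintype.card G * if j = l then 1 else 0 := by
    have h : ∀ g, (P g * (Matrix.single l j (1 : ℂ) * (P g)ᴴ)).trace = if j = l then 1 else 0 := by
      intro g
      rw [Matrix.trace_mul_comm, Matrix.mul_assoc, hPstar, Matrix.mul_one]
      split_ifs with h
      · simp [h]
      · exact Matrix.trace_single_eq_of_ne _ _ _ (Ne.symm h)
    simp only [M, Matrix.trace_sum, h]
    simp
  rw [hentry, eq_trace_smul_one_of_commute π M hM, htr]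
  by_cases h1 : i = k <;> by_cases h2 : j = l <;>
    simp [h1, h2, div_eq_mul_inv, mul_comm, Ne.symm]

/-- Summing an irreducible unitary representation over a conjugation-invariant set gives a scalar
matrix. -/
theorem sum_coeff_of_conj_invariant [Fintype G] (π : IrredUnitaryRep G) (s : Finset G)
    (hs : ∀ x, ∀ y ∈ s, x * y * x⁻¹ ∈ s) (k j : Fin π.deg) :
    ∑ y ∈ s, π.coeff k j y =
      if k = j then (1 / π.deg : ℂ) * ∑ y ∈ s, π.character y else 0 := by
  let M : Matrix (Fin π.deg) (Fin π.deg) ℂ := ∑ y ∈ s, (π.toHom y : Matrix _ _ ℂ)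
  have hM : ∀ x, M * (π.toHom x : Matrix (Fin π.deg) (Fin π.deg) ℂ) = π.toHom x * M := by
    intro x
    simp only [M, Matrix.sum_mul, Matrix.mul_sum]
    -- Reindexing by conjugation works because `x * y = (x * y * x⁻¹) * x`.
    refine (Finset.sum_bij' (fun y _ => x * y * x⁻¹) (fun y _ => x⁻¹ * y * x) (fun y hy => hs x y hy)
      (fun y hy => by simpa using hs x⁻¹ y hy) (fun y _ => by group) (fun y _ => by group)
      fun y _ => ?_).symm
    rw [← Submonoid.coe_mul, ← Submonoid.coe_mul, ← map_mul, ← map_mul]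
    congr 2
    group
  have h := congrFun (congrFun (eq_trace_smul_one_of_commute π M hM) k) j
  have htr : M.trace = ∑ y ∈ s, π.character y := by simp [M, Matrix.trace_sum, character]
  rw [htr] at h
  simpa [M, Matrix.sum_apply, Matrix.one_apply, coeff] using h

end IrredUnitaryRep

/-! ### Orthonormality, vertex sums and eigenvectors. -/

section Basis

variable {G : Type*} [Group G] [Fintype G]

theorem cayleyBasis_apply (rep : UnitaryDual G → IrredUnitaryRep G) (a : CoeffIndex rep) (x : G) :
    cayleyBasis rep a x =
      (Real.sqrt ((rep a.1).deg / Fintype.card G) : ℂ) * (rep a.1).coeff a.2.1 a.2.2 x := rfl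

theorem cayleyBasis_orthonormal (rep : UnitaryDual G → IrredUnitaryRep G)
    (hrep : ∀ π : UnitaryDual G, (rep π).cls = π) : Orthonormal ℂ (cayleyBasis rep) := by
  classical
  rw [orthonormal_iff_ite]
  have key : ∀ a b : CoeffIndex rep, inner ℂ (cayleyBasis rep a) (cayleyBasis rep b) =
      (Real.sqrt ((rep a.1).deg / Fintype.card G) : ℂ) *
        (Real.sqrt ((rep b.1).deg / Fintype.card G) : ℂ) *
        ∑ g, star ((rep a.1).coeff a.2.1 a.2.2 g) * (rep b.1).coeff b.2.1 b.2.2 g := by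
    intro a b
    simp only [PiLp.inner_apply, cayleyBasis_apply, RCLike.inner_apply, map_mul,
      Complex.conj_ofReal, Finset.mul_sum]
    refine Finset.sum_congr rfl fun g _ => ?_
    simp only [starRingEnd_apply]
    ring
  rintro ⟨π, i, j⟩ ⟨σ, k, l⟩
  rw [key]
  by_cases h : π = σ
  · subst h
    simp only [IrredUnitaryRep.sum_star_coeff_mul_coeff]
    have hd : ((rep π).deg : ℂ) ≠ 0 := by exact_mod_cast (rep π).deg_pos.ne'
    have hN : (Fintype.card G : ℂ) ≠ 0 := by exact_mod_cast Fintype.card_ne_zero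
    -- The squared scaling `d_π / N` cancels the Schur constant `N / d_π`.
    rw [← Complex.ofReal_mul, Real.mul_self_sqrt (by positivity)]
    by_cases h' : i = k ∧ j = l
    · simp [h'.1, h'.2, hd, hN]
    · rw [if_neg h', if_neg (by simpa using h')]
      simp
  · rw [IrredUnitaryRep.sum_coeff_eq_zero _ _ (by rwa [hrep, hrep]), if_neg, mul_zero]
    intro h'
    exact h (congrArg Sigma.fst h')

/-- At each vertex, the squared moduli of the basis vectors of one class sum to `d_π ^ 2 / N`. -/
theorem sum_norm_sq_cayleyBasis (rep : UnitaryDual G → IrredUnitaryRep G) (π : UnitaryDual G)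
    (x : G) :
    ∑ p : Fin (rep π).deg × Fin (rep π).deg, ‖cayleyBasis rep ⟨π, p⟩ x‖ ^ 2 =
      1 / (Fintype.card G : ℝ) * ((rep π).deg : ℝ) ^ 2 := by
  -- Columns of a unitary matrix are unit vectors, so the block contributes `d_π`, scaled by `d_π /
  -- N`.
  have h : ∀ j, ∑ i, ‖(rep π).coeff i j x‖ ^ 2 = 1 := by
    intro j
    have h := (rep π).sum_star_coeff_mul_coeff_self j j x
    simp only [← starRingEnd_apply, Complex.conj_mul', if_true] at h
    exact_mod_cast h
  simp only [cayleyBasis_apply, norm_mul, mul_pow, ← Finset.mul_sum]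
  rw [Fintype.sum_prod_type_right]
  simp only [h, Complex.norm_real, Real.norm_eq_abs, sq_abs]
  rw [Real.sq_sqrt (by positivity)]
  simp
  ring

-- Substituting `y = x * s` gives `∑ s, φ (x * s)`; expanding `π(x * s) = π(x) π(s)` leaves the
-- scalar matrix `∑ π(s)` on the right.
open Classical in
theorem digraphAdjMatrix_mulVec_cayleyBasis (S : Set G)
    (hS : ∀ x : G, (fun s => x * s * x⁻¹) '' S = S)
    (rep : UnitaryDual G → IrredUnitaryRep G) (a : CoeffIndex rep) :
    digraphAdjMatrix (cayleyDigraph S) *ᵥ (fun x => cayleyBasis rep a x) =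
      ((1 / (rep a.1).deg : ℂ) * ∑ s ∈ S.toFinset, (rep a.1).character s) •
        fun x => cayleyBasis rep a x := by
  ext x
  have h1 : (digraphAdjMatrix (cayleyDigraph S) *ᵥ (fun x => cayleyBasis rep a x)) x =
      ∑ s ∈ S.toFinset, cayleyBasis rep a (x * s) := by
    simp only [Matrix.mulVec, dotProduct, digraphAdjMatrix, cayleyDigraph, Matrix.of_apply]
    rw [← Equiv.sum_comp (Equiv.mulLeft x), show S.toFinset = Finset.univ.filter (· ∈ S) by
      ext; simp, Finset.sum_filter]
    simp
  rw [h1]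
  have hs : ∀ x, ∀ y ∈ S.toFinset, x * y * x⁻¹ ∈ S.toFinset := by
    intro x y hy
    rw [Set.mem_toFinset] at hy ⊢
    rw [← hS x]
    exact ⟨y, hy, rfl⟩
  simp only [cayleyBasis_apply, IrredUnitaryRep.coeff_mul, Pi.smul_apply, smul_eq_mul]
  rw [← Finset.mul_sum, Finset.sum_comm]
  simp only [← Finset.mul_sum, IrredUnitaryRep.sum_coeff_of_conj_invariant _ _ hs]
  simp
  ring

end Basis

/-! ### Completeness of the matrix coefficients. -/

/-- Every nonzero invariant subspace contains a minimal nonzero invariant subspace. -/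
theorem exists_minimal_invariant {ι E : Type*} [AddCommGroup E] [Module ℂ E]
    [FiniteDimensional ℂ E] (ρ : ι → E → E) (V : Submodule ℂ E)
    (hinv : ∀ g, ∀ v ∈ V, ρ g v ∈ V) (hne : V ≠ ⊥) :
    ∃ M ≤ V, (∀ g, ∀ v ∈ M, ρ g v ∈ M) ∧ M ≠ ⊥ ∧
      ∀ M' ≤ M, (∀ g, ∀ v ∈ M', ρ g v ∈ M') → M' = ⊥ ∨ M' = M := by
  obtain ⟨M, ⟨hMV, hMinv, hM⟩, hmin⟩ := wellFounded_lt.has_min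
    {M : Submodule ℂ E | M ≤ V ∧ (∀ g, ∀ v ∈ M, ρ g v ∈ M) ∧ M ≠ ⊥} ⟨V, le_rfl, hinv, hne⟩
  refine ⟨M, hMV, hMinv, hM, fun M' hM' hinv' => ?_⟩
  by_contra! h
  exact hmin M' ⟨hM'.trans hMV, hinv', h.1⟩ (lt_of_le_of_ne hM' h.2)

section Completeness

variable {G : Type*} [Group G]

/-- A minimal nonzero invariant subspace of a unitary representation is spanned by an orthonormal
basis in which the group acts by an irreducible unitary matrix representation. -/
theorem exists_irredUnitaryRep_of_minimal_invariant {E : Type*} [NormedAddCommGroup E]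
    [InnerProductSpace ℂ E] [FiniteDimensional ℂ E] (ρ : G →* (E ≃ₗᵢ[ℂ] E)) (M : Submodule ℂ E)
    (hinv : ∀ g, ∀ v ∈ M, ρ g v ∈ M) (hne : M ≠ ⊥)
    (hmin : ∀ M' ≤ M, (∀ g, ∀ v ∈ M', ρ g v ∈ M') → M' = ⊥ ∨ M' = M) :
    ∃ (π : IrredUnitaryRep G) (e : OrthonormalBasis (Fin π.deg) ℂ M),
      ∀ g j, ρ g (e j) = ∑ i, π.coeff i j g • (e i : E) := by
  let e := stdOrthonormalBasis ℂ M
  let U : G → Matrix (Fin (Module.finrank ℂ M)) (Fin (Module.finrank ℂ M)) ℂ :=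
    fun g => Matrix.of fun i j => inner ℂ (e i : E) (ρ g (e j))
  have hU : ∀ g i j, U g i j = inner ℂ (e i : E) (ρ g (e j)) := fun _ _ _ => rfl
  have hexp : ∀ g j, ρ g (e j) = ∑ i, U g i j • (e i : E) := by
    intro g j
    have h := e.sum_repr' ⟨ρ g (e j), hinv g _ (e j).2⟩
    have h' := congrArg (Submodule.subtype M) h
    simpa [hU] using h'.symm
  have hmul : ∀ x y, U (x * y) = U x * U y := by
    intro x y
    ext i j
    rw [hU, map_mul, LinearIsometryEquiv.coe_mul, Function.comp_apply, hexp y j, map_sum,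
      inner_sum, Matrix.mul_apply]
    refine Finset.sum_congr rfl fun k _ => ?_
    rw [map_smul, inner_smul_right, hU x, mul_comm]
  have hone : U 1 = 1 := by
    ext i j
    rw [hU, map_one, LinearIsometryEquiv.coe_one, id, ← Submodule.coe_inner,
      orthonormal_iff_ite.mp e.orthonormal, Matrix.one_apply]
  have hstar : ∀ g, star (U g) = U g⁻¹ := by
    intro g
    ext i j
    rw [Matrix.star_apply, hU, hU, ← starRingEnd_apply, inner_conj_symm,
      ← (ρ g).inner_map_map (e i : E) (ρ g⁻¹ (e j))]
    congr 1
    rw [← Function.comp_apply (f := ρ g), ← LinearIsometryEquiv.coe_mul, ← map_mul]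
    simp
  let u : G →* Matrix.unitaryGroup (Fin (Module.finrank ℂ M)) ℂ :=
    { toFun := fun g => ⟨U g, by
        rw [Matrix.mem_unitaryGroup_iff, hstar, ← hmul, mul_inv_cancel, hone]⟩
      map_one' := Subtype.ext hone
      map_mul' := fun x y => Subtype.ext (hmul x y) }
  -- `L` carries `u` to `ρ` on `M`, so subrepresentations of `u` become invariant subspaces of `M`,
  -- and minimality gives irreducibility.
  let L : (Fin (Module.finrank ℂ M) → ℂ) →ₗ[ℂ] E :=
    M.subtype ∘ₗ (e.toBasis.equivFun.symm : (Fin (Module.finrank ℂ M) → ℂ) →ₗ[ℂ] M)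
  have hLapp : ∀ w, L w = ∑ i, w i • (e i : E) := by
    intro w
    change M.subtype (e.toBasis.equivFun.symm w) = _
    rw [Module.Basis.equivFun_symm_apply, map_sum]
    simp
  have hLinj : Function.Injective L :=
    M.injective_subtype.comp e.toBasis.equivFun.symm.injective
  have hLrange : LinearMap.range L = M := by
    simp [L, LinearMap.range_comp]
  have hLρ : ∀ g w, ρ g (L w) = L (unitaryToRepresentation u g w) := by
    intro g w
    rw [hLapp, hLapp, map_sum]
    simp only [map_smul, hexp, Finset.smul_sum]
    rw [Finset.sum_comm]
    refine Finset.sum_congr rfl fun i _ => ?_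
    change _ = (U g *ᵥ w) i • (e i : E)
    rw [Matrix.mulVec, dotProduct, Finset.sum_smul]
    refine Finset.sum_congr rfl fun k _ => ?_
    rw [smul_smul, mul_comm]
  have hirr : (unitaryToRepresentation u).IsIrreducible :=
    { exists_pair_ne := ⟨⊥, ⊤, fun h => hne (by
        have h' : (⊥ : Submodule ℂ (Fin (Module.finrank ℂ M) → ℂ)) = ⊤ :=
          congrArg Subrepresentation.toSubmodule h
        rw [← hLrange, LinearMap.range_eq_map, ← h', Submodule.map_bot])⟩
      eq_bot_or_eq_top := fun N => by
        rcases hmin (N.toSubmodule.map L) (LinearMap.map_le_range.trans hLrange.le) (by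
          rintro g _ ⟨w, hw, rfl⟩
          exact ⟨_, N.apply_mem_toSubmodule g hw, (hLρ g w).symm⟩) with h | h
        · left
          apply Subrepresentation.toSubmodule_injective
          apply Submodule.map_injective_of_injective hLinj
          rw [h]
          exact (Submodule.map_bot L).symm
        · right
          apply Subrepresentation.toSubmodule_injective
          apply Submodule.map_injective_of_injective hLinj
          rw [h]
          exact (hLrange.symm.trans (LinearMap.range_eq_map L)) }
  exact ⟨⟨Module.finrank ℂ M, u, hirr⟩, e, hexp⟩

/-- An equivalence `T` gives `π(g) = T⁻¹ σ(g) T`, whose entries combine those of `σ(g)` with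
coefficients independent of `g`; `T` need not be unitary. -/
theorem IrredUnitaryRep.coeff_mem_span_of_cls_eq (π σ : IrredUnitaryRep G) (h : π.cls = σ.cls)
    (i j : Fin π.deg) :
    WithLp.toLp 2 (π.coeff i j) ∈ Submodule.span ℂ (Set.range
      fun p : Fin σ.deg × Fin σ.deg => (WithLp.toLp 2 (σ.coeff p.1 p.2) : EuclideanSpace ℂ G)) := by
  obtain ⟨e⟩ : Nonempty (π.toRep.Equiv σ.toRep) := Quotient.exact h
  let T := e.toLinearEquiv
  have hT : ∀ g w, T (π.toRep g w) = σ.toRep g (T w) := fun g w =>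
    e.toIntertwiningMap.isIntertwining _ _ g w
  have hcoeff : (WithLp.toLp 2 (π.coeff i j) : EuclideanSpace ℂ G) =
      ∑ k, ∑ l, (T.symm (Pi.single k 1) i * T (Pi.single j 1) l) •
        WithLp.toLp 2 (σ.coeff k l) := by
    ext g
    have h1 : π.coeff i j g = (π.toRep g (Pi.single j 1)) i := by
      change _ = ((π.toHom g : Matrix (Fin π.deg) (Fin π.deg) ℂ) *ᵥ Pi.single j 1) i
      simp [IrredUnitaryRep.coeff]
    have h2 : ∀ w, σ.toRep g w = ∑ k, (∑ l, σ.coeff k l g * w l) • Pi.single k (1 : ℂ) := by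
      intro w
      change (σ.toHom g : Matrix (Fin σ.deg) (Fin σ.deg) ℂ) *ᵥ w = _
      ext k
      simp [Finset.sum_apply, Pi.single_apply, Matrix.mulVec, dotProduct, IrredUnitaryRep.coeff]
    rw [PiLp.toLp_apply, h1, ← T.symm_apply_apply (π.toRep g (Pi.single j 1)), hT, h2, map_sum]
    simp only [map_smul, Finset.sum_apply, Pi.smul_apply, smul_eq_mul, WithLp.ofLp_sum,
      WithLp.ofLp_smul, Finset.sum_mul]
    refine Finset.sum_congr rfl fun k _ => Finset.sum_congr rfl fun l _ => ?_
    ring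
  rw [hcoeff]
  exact Submodule.sum_mem _ fun k _ => Submodule.sum_mem _ fun l _ =>
    Submodule.smul_mem _ _ (Submodule.subset_span ⟨(k, l), rfl⟩)

variable [Fintype G]

/-- Right translation on `ℂ^G`. -/
noncomputable def rightTranslation (G : Type*) [Group G] [Fintype G] :
    G →* (EuclideanSpace ℂ G ≃ₗᵢ[ℂ] EuclideanSpace ℂ G) where
  toFun g := LinearIsometryEquiv.piLpCongrLeft 2 ℂ ℂ (Equiv.mulRight g⁻¹)
  map_one' := by
    ext v x
    change v (x * 1⁻¹⁻¹) = v x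
    simp
  map_mul' x y := by
    ext v z
    change v (z * (x * y)⁻¹⁻¹) = v (z * x⁻¹⁻¹ * y⁻¹⁻¹)
    simp [mul_assoc]

theorem rightTranslation_apply (g : G) (v : EuclideanSpace ℂ G) (x : G) :
    rightTranslation G g v x = v (x * g) := by
  change v (x * g⁻¹⁻¹) = v (x * g)
  rw [inv_inv]

theorem coeff_mem_span_cayleyBasis (rep : UnitaryDual G → IrredUnitaryRep G)
    (hrep : ∀ π : UnitaryDual G, (rep π).cls = π) (π : IrredUnitaryRep G) (i j : Fin π.deg) :
    WithLp.toLp 2 (π.coeff i j) ∈ Submodule.span ℂ (Set.range (cayleyBasis rep)) := by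
  refine Submodule.span_le.mpr ?_
    (π.coeff_mem_span_of_cls_eq (rep π.cls) (hrep π.cls).symm i j)
  rintro _ ⟨p, rfl⟩
  have hc : (Real.sqrt ((rep π.cls).deg / Fintype.card G) : ℂ) ≠ 0 := by
    have := (rep π.cls).deg_pos
    have : (0 : ℝ) < Real.sqrt ((rep π.cls).deg / Fintype.card G) := by positivity
    exact_mod_cast this.ne'
  rw [SetLike.mem_coe, ← Submodule.smul_mem_iff _ hc]
  exact Submodule.subset_span ⟨⟨π.cls, p⟩, rfl⟩

/-- If `Wᗮ` were nonzero, a basis vector of a minimal invariant subspace of it would also lie in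
`W`, hence vanish. -/
theorem span_cayleyBasis (rep : UnitaryDual G → IrredUnitaryRep G)
    (hrep : ∀ π : UnitaryDual G, (rep π).cls = π) :
    Submodule.span ℂ (Set.range (cayleyBasis rep)) = ⊤ := by
  set W := Submodule.span ℂ (Set.range (cayleyBasis rep)) with hW
  have hWinv : ∀ g, ∀ v ∈ W, rightTranslation G g v ∈ W := by
    intro g v hv
    induction hv using Submodule.span_induction with
    | mem v hv =>
      obtain ⟨⟨π, i, j⟩, rfl⟩ := hv
      have h : rightTranslation G g (cayleyBasis rep ⟨π, i, j⟩) =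
          ∑ k, (rep π).coeff k j g • cayleyBasis rep ⟨π, i, k⟩ := by
        ext x
        simp only [rightTranslation_apply, cayleyBasis_apply, IrredUnitaryRep.coeff_mul,
          WithLp.ofLp_sum, WithLp.ofLp_smul, Finset.sum_apply, Pi.smul_apply, smul_eq_mul,
          Finset.mul_sum]
        refine Finset.sum_congr rfl fun k _ => ?_
        ring
      rw [h]
      exact Submodule.sum_mem _ fun k _ => Submodule.smul_mem _ _ (Submodule.subset_span ⟨_, rfl⟩)
    | zero => simp
    | add u v _ _ hu hv => rw [map_add]; exact add_mem hu hv
    | smul c v _ hv => rw [map_smul]; exact Submodule.smul_mem _ _ hv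
  have hperp : ∀ g, ∀ v ∈ Wᗮ, rightTranslation G g v ∈ Wᗮ := by
    intro g v hv w hw
    have h : rightTranslation G g (rightTranslation G g⁻¹ w) = w := by
      ext x
      simp
    rw [← h, LinearIsometryEquiv.inner_map_map]
    exact hv _ (hWinv _ _ hw)
  rw [← Submodule.orthogonal_eq_bot_iff]
  by_contra hne
  obtain ⟨M, hMW, hMinv, hM, hmin⟩ :=
    exists_minimal_invariant (fun g => rightTranslation G g) Wᗮ hperp hne
  obtain ⟨π, e, he⟩ :=
    exists_irredUnitaryRep_of_minimal_invariant (rightTranslation G) M hMinv hM hmin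
  let j : Fin π.deg := ⟨0, π.deg_pos⟩
  have hej : (e j : EuclideanSpace ℂ G) =
      ∑ i, (e i : EuclideanSpace ℂ G) 1 • WithLp.toLp 2 (π.coeff i j) := by
    ext g
    -- Evaluating the translate at the identity recovers `e j` at `g`, exhibiting `e j` as a
    -- combination of coefficients of `π`.
    have h := congrArg (fun v : EuclideanSpace ℂ G => v 1) (he g j)
    simp only [rightTranslation_apply, one_mul] at h
    rw [h]
    simp [Finset.sum_apply, mul_comm]
  have hmem : (e j : EuclideanSpace ℂ G) ∈ W := by
    rw [hej]
    exact Submodule.sum_mem _ fun i _ =>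
      Submodule.smul_mem _ _ (coeff_mem_span_cayleyBasis rep hrep π i j)
  have h0 : inner ℂ (e j : EuclideanSpace ℂ G) (e j) = 0 := hMW (e j).2 _ hmem
  rw [inner_self_eq_zero] at h0
  exact e.orthonormal.ne_zero j (Subtype.ext h0)

end Completeness

/-! ### Tight frames and the double Parseval identity. -/

section Frames

theorem isTightFrameWithBound_of_sum_eq {ι H : Type*} [Fintype ι] [NormedAddCommGroup H]
    [InnerProductSpace ℂ H] [Nontrivial H] {ψ : ι → H} {c : ℝ} (hc : 0 < c)
    (h : ∀ f : H, ∑ x, ‖inner ℂ (ψ x) f‖ ^ 2 = c * ‖f‖ ^ 2) : IsTightFrameWithBound ψ c := by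
  have hl : c ∈ lowerFrameBounds ψ := ⟨hc, fun f => (h f).ge⟩
  have hu : c ∈ upperFrameBounds ψ := ⟨hc, fun f => (h f).le⟩
  obtain ⟨v, hv⟩ := exists_ne (0 : H)
  have hv' : 0 < ‖v‖ ^ 2 := by positivity
  refine ⟨⟨⟨c, hl⟩, ⟨c, hu⟩⟩, ⟨hl, fun A hA => ?_⟩, ⟨hu, fun B hB => ?_⟩⟩
  · exact le_of_mul_le_mul_right ((hA.2 v).trans (h v).le) hv'
  · exact le_of_mul_le_mul_right ((h v).ge.trans (hB.2 v)) hv'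

theorem fourierMultiplier_mulVec_apply {V κ : Type*} [Fintype V] [Fintype κ]
    (φ : κ → EuclideanSpace ℂ V) (w : EuclideanSpace ℂ κ) (g : EuclideanSpace ℂ V) (x : V) :
    (fourierMultiplier φ w *ᵥ fun y => g y) x = ∑ a, w a * graphFourier φ g a * φ a x := by
  classical
  have h : ∀ a, ((synthesisMatrix φ)ᴴ *ᵥ fun y => g y) a = graphFourier φ g a := by
    intro a
    simp [graphFourier, synthesisMatrix, Matrix.mulVec, dotProduct, PiLp.inner_apply, mul_comm]
  rw [fourierMultiplier, Matrix.mul_assoc, ← Matrix.mulVec_mulVec, ← Matrix.mulVec_mulVec]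
  rw [Matrix.mulVec, dotProduct]
  refine Finset.sum_congr rfl fun a _ => ?_
  have hd := Matrix.mulVec_diagonal (fun a => w a) ((synthesisMatrix φ)ᴴ *ᵥ fun y => g y) a
  rw [h] at hd
  simp only [synthesisMatrix, Matrix.of_apply] at hd ⊢
  rw [mul_comm]
  congr 1

/-- Parseval's identity applied twice to the family `φ_ℓ ∘ (A_m g)`. -/
theorem sum_norm_inner_gaborFamily_sq {V κ ι : Type*} [Fintype V] [Fintype κ] [Fintype ι]
    (φ : OrthonormalBasis κ ℂ (EuclideanSpace ℂ V))
    (w : OrthonormalBasis ι ℂ (EuclideanSpace ℂ κ)) (g f : EuclideanSpace ℂ V) :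
    ∑ p, ‖inner ℂ (gaborFamily φ (fun m => fourierMultiplier φ (w m)) g p) f‖ ^ 2 =
      ∑ x, (∑ a, ‖graphFourier φ g a‖ ^ 2 * ‖φ a x‖ ^ 2) * ‖f x‖ ^ 2 := by
  let A : ι → V → ℂ := fun m x => (fourierMultiplier φ (w m) *ᵥ fun y => g y) x
  have h1 : ∀ m, ∑ l, ‖inner ℂ
      (gaborFamily φ (fun m => fourierMultiplier φ (w m)) g (m, l)) f‖ ^ 2 =
      ∑ x, ‖A m x‖ ^ 2 * ‖f x‖ ^ 2 := by
    intro m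
    -- Moving the factor `A m x` to the other side leaves Fourier coefficients of a single vector,
    -- so Parseval in `ℓ` applies.
    let h : EuclideanSpace ℂ V := WithLp.toLp 2 fun x => star (A m x) * f x
    have hin : ∀ l, inner ℂ (gaborFamily φ (fun m => fourierMultiplier φ (w m)) g (m, l)) f =
        inner ℂ (φ l) h := by
      intro l
      simp only [gaborFamily, PiLp.inner_apply, RCLike.inner_apply, h, A, map_mul,
        ← starRingEnd_apply]
      refine Finset.sum_congr rfl fun x _ => ?_
      ring
    simp only [hin]
    rw [φ.sum_sq_norm_inner_right, EuclideanSpace.norm_sq_eq]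
    simp [h, mul_pow]
  have h2 : ∀ x, ∑ m, ‖A m x‖ ^ 2 = ∑ a, ‖graphFourier φ g a‖ ^ 2 * ‖φ a x‖ ^ 2 := by
    intro x
    -- At a fixed vertex `A m x` is linear in `w m`; `q` represents this functional, so Parseval in
    -- `m` applies.
    let q : EuclideanSpace ℂ κ := WithLp.toLp 2 fun a => star (graphFourier φ g a * φ a x)
    have hin : ∀ m, A m x = inner ℂ q (w m) := by
      intro m
      simp only [A, fourierMultiplier_mulVec_apply, PiLp.inner_apply, RCLike.inner_apply, q,
        starRingEnd_apply, star_star, mul_assoc]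
    simp only [hin]
    rw [w.sum_sq_norm_inner_left, EuclideanSpace.norm_sq_eq]
    simp [q, mul_pow]
  rw [Fintype.sum_prod_type]
  simp only [h1]
  rw [Finset.sum_comm]
  simp only [← Finset.sum_mul, h2]

end Frames

/-! ### Assembly of the theorem. -/

open Classical in
theorem mainTheorem3 {G : Type*} [Group G] [Fintype G]
    (S : Set G) (hS : ∀ x : G, (fun s => x * s * x⁻¹) '' S = S)
    (rep : UnitaryDual G → IrredUnitaryRep G)
    (hrep : ∀ π : UnitaryDual G, (rep π).cls = π) :
    (Orthonormal ℂ (cayleyBasis rep) ∧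
      Submodule.span ℂ (Set.range (cayleyBasis rep)) = ⊤) ∧
    (∀ a : CoeffIndex rep,
      digraphAdjMatrix (cayleyDigraph S) *ᵥ (fun x => cayleyBasis rep a x) =
        ((1 / (rep a.1).deg : ℂ) * ∑ s ∈ S.toFinset, (rep a.1).character s) •
          fun x => cayleyBasis rep a x) ∧
    ∀ (g : EuclideanSpace ℂ G) (ghat : UnitaryDual G → ℂ)
      (f : OrthonormalBasis (Fin (Fintype.card G)) ℂ (EuclideanSpace ℂ (CoeffIndex rep))),
      g ≠ 0 →
      (∀ (π : UnitaryDual G) (i j : Fin (rep π).deg),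
        graphFourier (cayleyBasis rep) g ⟨π, (i, j)⟩ = ghat π) →
      IsTightFrameWithBound
        (gaborFamily (cayleyBasis rep) (fun m => fourierMultiplier (cayleyBasis rep) (f m)) g)
        (1 / (Fintype.card G : ℝ) * ∑ π : UnitaryDual G, ‖ghat π‖ ^ 2 * ((rep π).deg : ℝ) ^ 2) := by
  have hon := cayleyBasis_orthonormal rep hrep
  have hspan := span_cayleyBasis rep hrep
  refine ⟨⟨hon, hspan⟩, digraphAdjMatrix_mulVec_cayleyBasis S hS rep, ?_⟩
  intro g ghat f hg hghat
  let φ := OrthonormalBasis.mk hon hspan.ge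
  have hφ : ⇑φ = cayleyBasis rep := OrthonormalBasis.coe_mk hon hspan.ge
  refine isTightFrameWithBound_of_sum_eq ?_ fun h => ?_
  -- Positivity of the bound: if every `ghat π` vanished, Parseval would give `g = 0`.
  · obtain ⟨π, hπ⟩ : ∃ π, ghat π ≠ 0 := by
      by_contra! h0
      refine hg (norm_eq_zero.mp (sq_eq_zero_iff.mp ?_))
      rw [← φ.sum_sq_norm_inner_right, hφ]
      refine Finset.sum_eq_zero fun a _ => ?_
      have := hghat a.1 a.2.1 a.2.2
      rw [graphFourier, h0] at this
      simpa using this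
    have hd := (rep π).deg_pos
    refine mul_pos (by positivity) (Finset.sum_pos' (fun _ _ => by positivity)
      ⟨π, Finset.mem_univ _, by positivity⟩)
  · have key := sum_norm_inner_gaborFamily_sq φ f g h
    rw [hφ] at key
    rw [key, EuclideanSpace.norm_sq_eq, Finset.mul_sum]
    refine Finset.sum_congr rfl fun x _ => ?_
    congr 1
    -- Grouping by `π` lets the constant `‖ghat π‖ ^ 2` leave the block sum, removing the dependence
    -- on `x`.
    rw [Fintype.sum_sigma, Finset.mul_sum]
    refine Finset.sum_congr rfl fun π _ => ?_
    simp only [hghat]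
    rw [← Finset.mul_sum, sum_norm_sq_cayleyBasis]
    ring
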